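/- Conventions. For a semigroup $S$ and $x\in S$, $V(x)=\{y : xyx=x,\ yxy=y\}$. An inverse semigroup is a semigroup with $|V(x)|=1$ for all $x$; the inverse of $x$ is written $x^{-1}$. A semigroup is orthodox if it is regular and its idempotents form a subsemigroup. A subsemigroup $S^0$ of a regular semigroup $S$ is an inverse transversal of $S$ if it is an inverse semigroup and $|S^0\cap V(x)|=1$ for all $x\in S$; the unique element of $S^0\cap V(x)$ is written $x^0$, and $I(S)=\{xx^0 : x\in S\}$, $\Lambda(S)=\{x^0x : x\in S\}$. A left (right) regular band is a semigroup of idempotents with $xyx=xy$ (respectively $xyx=yx$). Theorem. Let $S^0$ be an inverse semigroup with semilattice of idempotents $E^0$, and let $I$ be a left regular band and $\Lambda$ a right regular band with common semilattice transversal $E^0$ (that is, $E^0$ is embedded as a subsemigroup in each of $I$ and $\Lambda$, and each element $e$ of $I$ or of $\Lambda$ has exactly one inverse $e^0$ in $E^0$). For $p\in E^0$ let $L_p$ be the $\mathcal L$-class of $p$ in $I$ and $R_p$ the $\mathcal R$-class of $p$ in $\Lambda$. Suppose that for all $x,y\in S^0$ there are partial maps $\alpha_{x,y}$ from $\Lambda\times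 I$ to $I$ and $\beta_{x,y}$ from $\Lambda\times I$ to $\Lambda$ (written on the right) such that, for all $x,y,z\in S^0$: (1) $\operatorname{dom}(\alpha_{x,y})=\operatorname{dom}(\beta_{x,y})\subseteq R_{x^{-1}x}\times L_{yy^{-1}}$, and on this domain $(f,e)\alpha_{x,y}\in L_{(xy)(xy)^{-1}}$ and $(f,e)\beta_{x,y}\in R_{(xy)^{-1}(xy)}$; (2) if $f\in R_{x^{-1}x}$, $g\in L_{yy^{-1}}$, $h\in R_{y^{-1}y}$, $k\in L_{zz^{-1}}$, then all terms below are defined (so that in fact $\operatorname{dom}(\alpha_{x,y})=R_{x^{-1}x}\times L_{yy^{-1}}$) and $$(f,g)\alpha_{x,y}\,\bigl((f,g)\beta_{x,y}h,k\bigr)\alpha_{xy,z}=\bigl(f,g(h,k)\alpha_{y,z}\bigr)\alpha_{x,yz},$$ $$\bigl(f,g(h,k)\alpha_{y,z}\bigr)\beta_{x,yz}\,(h,k)\beta_{y,z}=\bigl((f,g)\beta_{x,y}h,k\bigr)\beta_{xy,z};$$ (3) $(x^{-1}x,yy^{-1})\alpha_{x,y}=(xy)(xy)^{-1}$ and $(x^{-1}x,yy^{-1})\beta_{x,y}=(xy)^{-1}(xy)$.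 Let $$W=\{(e,x,f)\in I\times S^0\times\Lambda : e\in L_{xx^{-1}},\ f\in R_{x^{-1}x}\},\qquad (e,x,f)(g,y,h)=\bigl(e\,(f,g)\alpha_{x,y},\ xy,\ (f,g)\beta_{x,y}\,h\bigr).$$ Then $W$ is closed under this multiplication and is an orthodox semigroup, and $W^0=\{(xx^{-1},x,x^{-1}x) : x\in S^0\}$ is an inverse transversal of $W$ isomorphic to $S^0$. If in addition (4) for all $f\in\Lambda$, $e\in I$: $(f^0,e)\alpha_{f^0,e^0}=f^0e$ and $(f,e^0)\beta_{f^0,e^0}=fe^0$, then, with respect to the transversal $W^0$, $I(W)$ and $\Lambda(W)$ are subsemigroups of $W$ with $I(W)\cong I$ and $\Lambda(W)\cong\Lambda$. Conversely, every orthodox semigroup $S$ with an inverse transversal $S^0$ arises in this way: $I=I(S)$ and $\Lambda=\Lambda(S)$ are subsemigroups of $S$, a left regular and a right regular band with common semilattice transversal $E^0=E(S^0)$ (embedded by inclusion), and there are partial maps $\alpha_{x,y},\beta_{x,y}$ ($x,y\in S^0$) satisfying (1)–(4) and an isomorphism from $S$ onto the resulting semigroup $W$ which maps $S^0$ onto $W^0$.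 -/

import Mathlib

universe u v w

namespace InvTransversal

section Basic

variable {S : Type u} [Semigroup S]

/-- `y` is an inverse of `x`, i.e. `y ∈ V(x)`. -/
def IsInverse (x y : S) : Prop := x * y * x = x ∧ y * x * y = y

/-- Green's relation `L`: `S¹ a = S¹ b`. -/
def GreenL (a b : S) : Prop := (a = b ∨ ∃ u, a = u * b) ∧ (b = a ∨ ∃ v, b = v * a)

/-- Green's relation `R`: `a S¹ = b S¹`. -/
def GreenR (a b : S) : Prop := (a = b ∨ ∃ u, a = b * u) ∧ (b = a ∨ ∃ v, b = a * v)

end Basic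

/-- A regular semigroup. -/
def IsRegularSemigroup (S : Type u) [Semigroup S] : Prop := ∀ x : S, ∃ y, x * y * x = x

/-- An orthodox semigroup: regular, and the idempotents form a subsemigroup. -/
structure IsOrthodox (S : Type u) [Semigroup S] : Prop where
  regular : IsRegularSemigroup S
  idem_mul : ∀ e f : S, IsIdempotentElem e → IsIdempotentElem f → IsIdempotentElem (e * f)

/-- An inverse semigroup: every element has exactly one inverse. -/
class IsInverseSemigroup (S : Type u) [Semigroup S] : Prop where
  existsUnique_inverse : ∀ x : S, ∃! y, IsInverse x y

/-- A left regular band: all elements are idempotent and `x y x = x y`. -/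
structure IsLeftRegularBand (B : Type u) [Semigroup B] : Prop where
  idem : ∀ x : B, x * x = x
  leftRegular : ∀ x y : B, x * y * x = x * y

/-- A right regular band: all elements are idempotent and `x y x = y x`. -/
structure IsRightRegularBand (B : Type u) [Semigroup B] : Prop where
  idem : ∀ x : B, x * x = x
  rightRegular : ∀ x y : B, x * y * x = y * x

/-- `T` is an inverse transversal of `S`: `S` is regular, `T` is an inverse subsemigroup and
`|T ∩ V(x)| = 1` for all `x`. -/
structure IsInverseTransversal {S : Type u} [Semigroup S] (T : Subsemigroup S) : Prop where
  regular : IsRegularSemigroup S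
  inverse : IsInverseSemigroup T
  existsUnique_mem : ∀ x : S, ∃! y, y ∈ T ∧ IsInverse x y

/-- `I(S) = {x x⁰ : x ∈ S}`, where `x⁰` is the inverse of `x` in the transversal `T`. -/
def ISet {S : Type u} [Semigroup S] (T : Subsemigroup S) : Set S :=
  {e | ∃ x y, y ∈ T ∧ IsInverse x y ∧ e = x * y}

/-- `Λ(S) = {x⁰ x : x ∈ S}`, where `x⁰` is the inverse of `x` in the transversal `T`. -/
def LambdaSet {S : Type u} [Semigroup S] (T : Subsemigroup S) : Set S :=
  {f | ∃ x y, y ∈ T ∧ IsInverse x y ∧ f = y * x}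

section Inverse

variable {S : Type u} [Semigroup S] [IsInverseSemigroup S]

/-- The inverse `x⁻¹` of an element of an inverse semigroup. -/
noncomputable def sinv (x : S) : S :=
  (IsInverseSemigroup.existsUnique_inverse x).choose

theorem isInverse_sinv (x : S) : IsInverse x (sinv x) :=
  (IsInverseSemigroup.existsUnique_inverse x).choose_spec.1

theorem isIdempotentElem_mul_of_inverse {e f : S} (he : IsIdempotentElem e)
    (hf : IsIdempotentElem f) : IsIdempotentElem (e * f) := by
  have he' : ∀ a, e * (e * a) = e * a := fun a => by rw [← mul_assoc, he.eq]
  have hf' : ∀ a, f * (f * a) = f * a := fun a => by rw [← mul_assoc, hf.eq]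
  obtain ⟨x, ⟨h1, h2⟩, -⟩ := IsInverseSemigroup.existsUnique_inverse (e * f)
  have uniq : ∀ z a b : S, IsInverse z a → IsInverse z b → a = b := fun z a b ha hb =>
    (IsInverseSemigroup.existsUnique_inverse z).unique ha hb
  simp only [mul_assoc] at h1 h2
  have h2' : ∀ a, x * (e * (f * (x * a))) = x * a := fun a => by
    have := congrArg (· * a) h2
    simpa only [mul_assoc] using this
  have hx : x = f * (x * e) := by
    refine uniq (e * f) _ _ ⟨by simpa only [mul_assoc] using h1, by simpa only [mul_assoc] using h2⟩
      ⟨?_, ?_⟩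
    · simp only [mul_assoc, he', hf', h1]
    · simp only [mul_assoc, he', hf', h2']
  have hxx : x * x = x := by
    calc x * x = (f * (x * e)) * (f * (x * e)) := by rw [← hx]
      _ = f * (x * e) := by simp only [mul_assoc, h2']
      _ = x := hx.symm
  have hxef : x = e * f := by
    refine uniq x _ _ ⟨by rw [hxx, hxx], by rw [hxx, hxx]⟩ ⟨?_, ?_⟩
    · simpa only [mul_assoc] using h2
    · simpa only [mul_assoc] using h1
  rw [← hxef]
  exact hxx

variable (S) in
/-- The semilattice `E⁰` of idempotents of an inverse semigroup. -/
def Idem : Subsemigroup S where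
  carrier := {e | IsIdempotentElem e}
  mul_mem' := fun he hf => isIdempotentElem_mul_of_inverse he hf

/-- The idempotent `x x⁻¹`. -/
noncomputable def rg (x : S) : Idem S :=
  ⟨x * sinv x, by
    change x * sinv x * (x * sinv x) = x * sinv x
    rw [← mul_assoc, (isInverse_sinv x).1]⟩

/-- The idempotent `x⁻¹ x`. -/
noncomputable def dm (x : S) : Idem S :=
  ⟨sinv x * x, by
    change sinv x * x * (sinv x * x) = sinv x * x
    rw [← mul_assoc, (isInverse_sinv x).2]⟩

end Inverse

/-- A left regular band `I` and a right regular band `Λ` with the semilattice `E⁰` of idempotents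
of the inverse semigroup `S` as common semilattice transversal. The inclusions of `E⁰` in `I` and
in `Λ` are the embeddings `inI` and `inΛ`; being a transversal means that each element has exactly
one inverse in `E⁰`. -/
structure BandPair (S : Type u) (I : Type v) (Λ : Type w) [Semigroup S] [IsInverseSemigroup S]
    [Semigroup I] [Semigroup Λ] where
  leftRegular : IsLeftRegularBand I
  rightRegular : IsRightRegularBand Λ
  inI : Idem S →ₙ* I
  inΛ : Idem S →ₙ* Λ
  inI_injective : Function.Injective inI
  inΛ_injective : Function.Injective inΛ
  transversalI : ∀ e : I, ∃! p : Idem S, IsInverse e (inI p)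
  transversalΛ : ∀ f : Λ, ∃! p : Idem S, IsInverse f (inΛ p)

namespace BandPair

variable {S : Type u} {I : Type v} {Λ : Type w} [Semigroup S] [IsInverseSemigroup S]
  [Semigroup I] [Semigroup Λ] (B : BandPair S I Λ)

/-- The `L`-class `L_p ⊆ I` of `p ∈ E⁰`. -/
def LClass (p : Idem S) : Set I := {e | GreenL e (B.inI p)}

/-- The `R`-class `R_p ⊆ Λ` of `p ∈ E⁰`. -/
def RClass (p : Idem S) : Set Λ := {f | GreenR f (B.inΛ p)}

/-- Conditions (1), (2), (3) on two families of partial maps. -/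
structure IsAdmissible (α : S → S → (Λ × I →. I)) (β : S → S → (Λ × I →. Λ)) : Prop where
  dom_eq : ∀ x y, (α x y).Dom = (β x y).Dom
  dom_subset : ∀ x y, (α x y).Dom ⊆ B.RClass (dm x) ×ˢ B.LClass (rg y)
  α_mem : ∀ x y p, ∀ a ∈ α x y p, a ∈ B.LClass (rg (x * y))
  β_mem : ∀ x y p, ∀ b ∈ β x y p, b ∈ B.RClass (dm (x * y))
  /-- All terms in the two identities are defined, and the two sides are equal. -/
  assoc : ∀ x y z, ∀ f ∈ B.RClass (dm x), ∀ g ∈ B.LClass (rg y),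
    ∀ h ∈ B.RClass (dm y), ∀ k ∈ B.LClass (rg z),
    ∃ a ∈ α x y (f, g), ∃ b ∈ β x y (f, g), ∃ a' ∈ α y z (h, k), ∃ b' ∈ β y z (h, k),
    ∃ c ∈ α (x * y) z (b * h, k), ∃ d ∈ β (x * y) z (b * h, k),
    ∃ c' ∈ α x (y * z) (f, g * a'), ∃ d' ∈ β x (y * z) (f, g * a'),
      a * c = c' ∧ d' * b' = d
  α_base : ∀ x y, B.inI (rg (x * y)) ∈ α x y (B.inΛ (dm x), B.inI (rg y))
  β_base : ∀ x y, B.inΛ (dm (x * y)) ∈ β x y (B.inΛ (dm x), B.inI (rg y))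

/-- Condition (4): with `p = f⁰` and `q = e⁰`,
`(f⁰, e) α_{f⁰, e⁰} = f⁰ e` and `(f, e⁰) β_{f⁰, e⁰} = f e⁰`. -/
def IsCompatible (α : S → S → (Λ × I →. I)) (β : S → S → (Λ × I →. Λ)) : Prop :=
  ∀ (f : Λ) (e : I) (p q : Idem S), IsInverse f (B.inΛ p) → IsInverse e (B.inI q) →
    B.inI p * e ∈ α p q (B.inΛ p, e) ∧ f * B.inΛ q ∈ β p q (f, B.inI q)

/-- The set `W = {(e, x, f) : e ∈ L_{x x⁻¹}, f ∈ R_{x⁻¹ x}}`. -/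
@[ext]
structure W where
  e : I
  x : S
  f : Λ
  e_mem : e ∈ B.LClass (rg x)
  f_mem : f ∈ B.RClass (dm x)

variable {B} in
/-- `m` is the multiplication
`(e, x, f) (g, y, h) = (e (f, g) α_{x, y}, x y, (f, g) β_{x, y} h)` on `W`. -/
def IsProduct (α : S → S → (Λ × I →. I)) (β : S → S → (Λ × I →. Λ)) (m : B.W → B.W → B.W) :
    Prop :=
  ∀ s t : B.W, ∃ a ∈ α s.x t.x (s.f, t.e), ∃ b ∈ β s.x t.x (s.f, t.e),
    (m s t).e = s.e * a ∧ (m s t).x = s.x * t.x ∧ (m s t).f = b * t.f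

/-- The set `W⁰ = {(x x⁻¹, x, x⁻¹ x) : x ∈ S}`. -/
def W₀ : Set B.W := {s | s.e = B.inI (rg s.x) ∧ s.f = B.inΛ (dm s.x)}

end BandPair

end InvTransversal

namespace InvTransversal

/-! ### Inverses of products, and Green's relations in bands -/

section Semigroups

variable {S : Type u} [Semigroup S]

/-! For the direct half, associativity of `W` is exactly the pair of identities (2), read in the
outer coordinates. Everything else about `W` is governed by the middle coordinate. An `L`-class of a
left regular band is a left zero band, so whenever `x y` and `x` have the same range idempotent, the
value of `α` is absorbed and the first coordinate does not change; dually on the right (`mul_e_eq`,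
`mul_f_eq`). Hence a triple is idempotent iff its middle entry is, which gives orthodoxy, and the
inverse of `(e, x, f)` in `W⁰` is the triple built from `x⁻¹`. Condition (4) is needed only to
identify the products in `I(W)` and `Λ(W)` with those of the given bands.

For the converse, every `s` factors as `(s s⁰) s⁰⁰ (s⁰ s)`. In an orthodox semigroup an inverse of
`b` times an inverse of `a` is an inverse of `a b` (`IsInverse.mul`), so `u = x f g y` has `(x y)⁻¹`
as its inverse in the transversal (`isInverse_middle`). Factoring `u` in the same way gives `α = u
(x y)⁻¹` and `β = (x y)⁻¹ u`, with `u = α (x y) β`. Thus `(e, x, f) ↦ e x f` is multiplicative, and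
both sides of each identity in (2) collapse to one product. -/

theorem IsInverse.symm {x y : S} (h : IsInverse x y) : IsInverse y x := ⟨h.2, h.1⟩

/-- Closure of idempotents makes `(x' x)(y y')` and `(y y')(x' x)` idempotent; inserting `x = x x'
x` and `y = y y' y` exposes their squares in the middle. It serves both inverse and orthodox
semigroups. -/
theorem IsInverse.mul {x y x' y' : S}
    (hE : ∀ e f : S, IsIdempotentElem e → IsIdempotentElem f → IsIdempotentElem (e * f))
    (hx : IsInverse x x') (hy : IsInverse y y') : IsInverse (x * y) (y' * x') := by
  obtain ⟨hx1, hx2⟩ := hx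
  obtain ⟨hy1, hy2⟩ := hy
  have i1 : IsIdempotentElem (x' * x) := by rw [IsIdempotentElem, ← mul_assoc, hx2]
  have i2 : IsIdempotentElem (y * y') := by rw [IsIdempotentElem, ← mul_assoc, hy1]
  have h1 := (hE _ _ i1 i2).eq
  have h2 := (hE _ _ i2 i1).eq
  constructor
  · calc x * y * (y' * x') * (x * y)
        = (x * x' * x) * y * (y' * x') * (x * (y * y' * y)) := by rw [hx1, hy1]
      _ = x * (x' * x * (y * y') * (x' * x * (y * y'))) * y := by simp only [mul_assoc]
      _ = (x * x' * x) * (y * y' * y) := by rw [h1]; simp only [mul_assoc]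
      _ = x * y := by rw [hx1, hy1]
  · calc y' * x' * (x * y) * (y' * x')
        = (y' * y * y') * x' * (x * y) * (y' * (x' * x * x')) := by rw [hx2, hy2]
      _ = y' * (y * y' * (x' * x) * (y * y' * (x' * x))) * x' := by simp only [mul_assoc]
      _ = (y' * y * y') * (x' * x * x') := by rw [h2]; simp only [mul_assoc]
      _ = y' * x' := by rw [hx2, hy2]

theorem _root_.IsIdempotentElem.isInverse_self {e : S} (he : IsIdempotentElem e) :
    IsInverse e e := ⟨by rw [he.eq, he.eq], by rw [he.eq, he.eq]⟩

theorem greenL_iff (hS : ∀ x : S, x * x = x) {a b : S} :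
    GreenL a b ↔ a * b = a ∧ b * a = b := by
  constructor
  · rintro ⟨h1, h2⟩
    constructor
    · rcases h1 with rfl | ⟨u, rfl⟩
      · exact hS _
      · rw [mul_assoc, hS]
    · rcases h2 with rfl | ⟨u, rfl⟩
      · exact hS _
      · rw [mul_assoc, hS]
  · rintro ⟨h1, h2⟩
    exact ⟨.inr ⟨a, h1.symm⟩, .inr ⟨b, h2.symm⟩⟩

theorem greenR_iff (hS : ∀ x : S, x * x = x) {a b : S} :
    GreenR a b ↔ b * a = a ∧ a * b = b := by
  constructor
  · rintro ⟨h1, h2⟩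
    constructor
    · rcases h1 with rfl | ⟨u, rfl⟩
      · exact hS _
      · rw [← mul_assoc, hS]
    · rcases h2 with rfl | ⟨u, rfl⟩
      · exact hS _
      · rw [← mul_assoc, hS]
  · rintro ⟨h1, h2⟩
    exact ⟨.inr ⟨a, h1.symm⟩, .inr ⟨b, h2.symm⟩⟩

theorem IsLeftRegularBand.isInverse_iff (hS : IsLeftRegularBand S) {a b : S} :
    IsInverse a b ↔ a * b = a ∧ b * a = b := by
  rw [IsInverse, hS.leftRegular, hS.leftRegular]

theorem IsRightRegularBand.isInverse_iff (hS : IsRightRegularBand S) {a b : S} :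
    IsInverse a b ↔ b * a = a ∧ a * b = b := by
  rw [IsInverse, hS.rightRegular, hS.rightRegular]

end Semigroups

/-! ### Calculus of `x⁻¹`, `x x⁻¹` and `x⁻¹ x` in an inverse semigroup -/

section Inverse

variable {S : Type u} [Semigroup S] [IsInverseSemigroup S]

theorem sinv_eq {x y : S} (h : IsInverse x y) : sinv x = y :=
  (IsInverseSemigroup.existsUnique_inverse x).unique (isInverse_sinv x) h

theorem sinv_sinv (x : S) : sinv (sinv x) = x := sinv_eq (isInverse_sinv x).symm

theorem sinv_mul (x y : S) : sinv (x * y) = sinv y * sinv x :=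
  sinv_eq ((isInverse_sinv x).mul (fun _ _ => isIdempotentElem_mul_of_inverse) (isInverse_sinv y))

theorem idem_mul_comm (p q : Idem S) : p * q = q * p := by
  have hpq : IsIdempotentElem ((p : S) * q) := (p * q).2
  have h1 : sinv ((p : S) * q) = p * q := sinv_eq hpq.isInverse_self
  have h2 : sinv ((p : S) * q) = q * p := by
    rw [sinv_mul, sinv_eq p.2.isInverse_self, sinv_eq q.2.isInverse_self]
  exact Subtype.ext (h1.symm.trans h2)

theorem rg_mul_rg (x y : S) : rg (x * y) * rg x = rg (x * y) := by
  rw [idem_mul_comm]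
  refine Subtype.ext ?_
  change x * sinv x * (x * y * sinv (x * y)) = x * y * sinv (x * y)
  rw [← mul_assoc, ← mul_assoc (x * sinv x), (isInverse_sinv x).1]

theorem dm_mul_dm (x y : S) : dm y * dm (x * y) = dm (x * y) := by
  rw [idem_mul_comm]
  refine Subtype.ext ?_
  change sinv (x * y) * (x * y) * (sinv y * y) = sinv (x * y) * (x * y)
  rw [mul_assoc, mul_assoc x, ← mul_assoc y, (isInverse_sinv y).1]

theorem rg_idem (p : Idem S) : rg (p : S) = p :=
  Subtype.ext (by
    change (p : S) * sinv (p : S) = p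
    rw [sinv_eq p.2.isInverse_self, p.2.eq])

theorem dm_idem (p : Idem S) : dm (p : S) = p :=
  Subtype.ext (by
    change sinv (p : S) * (p : S) = p
    rw [sinv_eq p.2.isInverse_self, p.2.eq])

theorem rg_sinv (x : S) : rg (sinv x) = dm x :=
  Subtype.ext (by
    change sinv x * sinv (sinv x) = sinv x * x
    rw [sinv_sinv])

theorem dm_sinv (x : S) : dm (sinv x) = rg x :=
  Subtype.ext (by
    change sinv (sinv x) * sinv x = x * sinv x
    rw [sinv_sinv])

end Inverse

/-! ### The bands `I(S)` and `Λ(S)` of an orthodox semigroup -/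

section Transversal

variable {S : Type u} [Semigroup S] {T : Subsemigroup S}

/-- Both `p q` and `q p` are inverses of `p q` in the transversal, which contains only one. -/
theorem IsInverseTransversal.mul_comm (hT : IsInverseTransversal T) (hS : IsOrthodox S) {p q : S}
    (hpT : p ∈ T) (hqT : q ∈ T) (hp : IsIdempotentElem p) (hq : IsIdempotentElem q) :
    p * q = q * p :=
  (hT.existsUnique_mem (p * q)).unique
    ⟨T.mul_mem hpT hqT, (hS.idem_mul _ _ hp hq).isInverse_self⟩
    ⟨T.mul_mem hqT hpT, hp.isInverse_self.mul hS.idem_mul hq.isInverse_self⟩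

/-- Frees `I(S)` from the witness `x`: for `e = x x⁰` the idempotent is `x⁰⁰ x⁰`, and conversely `p`
serves as `e⁰`, with `e = e p`. -/
theorem IsInverseTransversal.mem_ISet_iff (hT : IsInverseTransversal T) {e : S} :
    e ∈ ISet T ↔ ∃ p ∈ T, IsIdempotentElem p ∧ e * p = e ∧ p * e = p := by
  constructor
  · rintro ⟨x, y, hy, hxy, rfl⟩
    obtain ⟨z, ⟨hz, hyz⟩, -⟩ := hT.existsUnique_mem y
    refine ⟨z * y, T.mul_mem hz hy, ?_, ?_, ?_⟩
    · rw [IsIdempotentElem, ← mul_assoc, hyz.2]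
    · rw [mul_assoc, ← mul_assoc y, hyz.1]
    · rw [mul_assoc, ← mul_assoc y, hxy.2]
  · rintro ⟨p, hp, -, h1, h2⟩
    have h3 : e * e = e := by
      nth_rw 1 [← h1]
      rw [mul_assoc, h2, h1]
    have hpp : p * p = p := by
      nth_rw 1 [← h2]
      rw [mul_assoc, h1, h2]
    exact ⟨e, p, hp, ⟨by rw [h1, h3], by rw [h2, hpp]⟩, h1.symm⟩

theorem IsInverseTransversal.mem_LambdaSet_iff (hT : IsInverseTransversal T) {f : S} :
    f ∈ LambdaSet T ↔ ∃ p ∈ T, IsIdempotentElem p ∧ p * f = f ∧ f * p = p := by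
  constructor
  · rintro ⟨x, y, hy, hxy, rfl⟩
    obtain ⟨z, ⟨hz, hyz⟩, -⟩ := hT.existsUnique_mem y
    refine ⟨y * z, T.mul_mem hy hz, ?_, ?_, ?_⟩
    · rw [IsIdempotentElem, ← mul_assoc, hyz.1]
    · rw [← mul_assoc, hyz.1]
    · rw [← mul_assoc, hxy.2]
  · rintro ⟨p, hp, -, h1, h2⟩
    have h3 : f * f = f := by
      nth_rw 2 [← h1]
      rw [← mul_assoc, h2, h1]
    have hpp : p * p = p := by
      nth_rw 2 [← h2]
      rw [← mul_assoc, h1, h2]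
    exact ⟨f, p, hp, ⟨by rw [mul_assoc, h1, h3], by rw [mul_assoc, h2, hpp]⟩, h1.symm⟩

/-- Orthodoxy makes `q p = p q` an inverse of `e g`, and commutation gives `p q e = p q`. So `p q`
absorbs `e g` on its right, whence `e g = e g (p q)`, and then `e g e = e g`. This yields both
closure of `I(S)` and left regularity. -/
theorem IsInverseTransversal.ISet_aux (hT : IsInverseTransversal T) (hS : IsOrthodox S)
    {e g p q : S} (hpT : p ∈ T) (hp : IsIdempotentElem p) (h1 : e * p = e) (h2 : p * e = p)
    (hqT : q ∈ T) (hq : IsIdempotentElem q) (h3 : g * q = g) (h4 : q * g = q) :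
    e * g * (p * q) = e * g ∧ p * q * (e * g) = p * q ∧ e * g * e = e * g := by
  have hc := hT.mul_comm hS hpT hqT hp hq
  have he : IsInverse e p := ⟨by rw [h1]; grind [mul_assoc], by rw [h2, hp.eq]⟩
  have hg : IsInverse g q := ⟨by rw [h3]; grind [mul_assoc], by rw [h4, hq.eq]⟩
  have hi := he.mul hS.idem_mul hg
  rw [← hc] at hi
  have hr : p * q * e = p * q := by rw [hc, mul_assoc, h2]
  have hrg : p * q * (e * g) = p * q := by rw [← mul_assoc, hr, mul_assoc, h4]
  have hl : e * g * (p * q) = e * g := by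
    conv_rhs => rw [← hi.1, mul_assoc, hrg]
  refine ⟨hl, hrg, ?_⟩
  rw [← hl, mul_assoc, hr]

theorem IsInverseTransversal.LambdaSet_aux (hT : IsInverseTransversal T) (hS : IsOrthodox S)
    {e g p q : S} (hpT : p ∈ T) (hp : IsIdempotentElem p) (h1 : p * e = e) (h2 : e * p = p)
    (hqT : q ∈ T) (hq : IsIdempotentElem q) (h3 : q * g = g) (h4 : g * q = q) :
    p * q * (e * g) = e * g ∧ e * g * (p * q) = p * q ∧ g * e * g = e * g := by
  have hc := hT.mul_comm hS hpT hqT hp hq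
  have he : IsInverse e p := ⟨by rw [h2, h1], by rw [mul_assoc, h2, hp.eq]⟩
  have hg : IsInverse g q := ⟨by rw [h4, h3], by rw [mul_assoc, h4, hq.eq]⟩
  have hi := he.mul hS.idem_mul hg
  rw [← hc] at hi
  have hr : g * (p * q) = p * q := by rw [hc, ← mul_assoc, h4]
  have hrg : e * g * (p * q) = p * q := by rw [mul_assoc, hr, ← mul_assoc, h2]
  have hl : p * q * (e * g) = e * g := by
    conv_rhs => rw [← hi.1, hrg]
  refine ⟨hl, hrg, ?_⟩
  rw [mul_assoc, ← hl, ← mul_assoc, hr]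

/-- `I(S)` as a subsemigroup of an orthodox semigroup. -/
def IsInverseTransversal.ISubsemigroup (hT : IsInverseTransversal T) (hS : IsOrthodox S) :
    Subsemigroup S where
  carrier := ISet T
  mul_mem' {a b} ha hb := by
    rw [hT.mem_ISet_iff] at ha hb ⊢
    obtain ⟨p, hpT, hp, h1, h2⟩ := ha
    obtain ⟨q, hqT, hq, h3, h4⟩ := hb
    have h := hT.ISet_aux hS hpT hp h1 h2 hqT hq h3 h4
    exact ⟨p * q, T.mul_mem hpT hqT, hS.idem_mul _ _ hp hq, h.1, h.2.1⟩

/-- `Λ(S)` as a subsemigroup of an orthodox semigroup. -/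
def IsInverseTransversal.LambdaSubsemigroup (hT : IsInverseTransversal T) (hS : IsOrthodox S) :
    Subsemigroup S where
  carrier := LambdaSet T
  mul_mem' {a b} ha hb := by
    rw [hT.mem_LambdaSet_iff] at ha hb ⊢
    obtain ⟨p, hpT, hp, h1, h2⟩ := ha
    obtain ⟨q, hqT, hq, h3, h4⟩ := hb
    have h := hT.LambdaSet_aux hS hpT hp h1 h2 hqT hq h3 h4
    exact ⟨p * q, T.mul_mem hpT hqT, hS.idem_mul _ _ hp hq, h.1, h.2.1⟩

theorem IsInverseTransversal.isLeftRegularBand (hT : IsInverseTransversal T) (hS : IsOrthodox S) :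
    IsLeftRegularBand (hT.ISubsemigroup hS) where
  idem := by
    rintro ⟨e, he⟩
    obtain ⟨p, -, -, h1, h2⟩ := hT.mem_ISet_iff.1 he
    refine Subtype.ext ?_
    change e * e = e
    grind [mul_assoc]
  leftRegular := by
    rintro ⟨e, he⟩ ⟨g, hg⟩
    obtain ⟨p, hpT, hp, h1, h2⟩ := hT.mem_ISet_iff.1 he
    obtain ⟨q, hqT, hq, h3, h4⟩ := hT.mem_ISet_iff.1 hg
    exact Subtype.ext (hT.ISet_aux hS hpT hp h1 h2 hqT hq h3 h4).2.2

theorem IsInverseTransversal.isRightRegularBand (hT : IsInverseTransversal T) (hS : IsOrthodox S) :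
    IsRightRegularBand (hT.LambdaSubsemigroup hS) where
  idem := by
    rintro ⟨e, he⟩
    obtain ⟨p, -, -, h1, h2⟩ := hT.mem_LambdaSet_iff.1 he
    refine Subtype.ext ?_
    change e * e = e
    grind [mul_assoc]
  rightRegular := by
    rintro ⟨e, he⟩ ⟨g, hg⟩
    obtain ⟨p, hpT, hp, h1, h2⟩ := hT.mem_LambdaSet_iff.1 he
    obtain ⟨q, hqT, hq, h3, h4⟩ := hT.mem_LambdaSet_iff.1 hg
    exact Subtype.ext (hT.LambdaSet_aux hS hqT hq h3 h4 hpT hp h1 h2).2.2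

end Transversal

/-! ### The multiplication on `W` -/

namespace BandPair

variable {S : Type u} {I : Type v} {Λ : Type w} [Semigroup S] [IsInverseSemigroup S]
  [Semigroup I] [Semigroup Λ] (B : BandPair S I Λ)

theorem mem_LClass {e : I} {p : Idem S} :
    e ∈ B.LClass p ↔ e * B.inI p = e ∧ B.inI p * e = B.inI p :=
  greenL_iff B.leftRegular.idem

theorem mem_RClass {f : Λ} {p : Idem S} :
    f ∈ B.RClass p ↔ B.inΛ p * f = f ∧ f * B.inΛ p = B.inΛ p :=
  greenR_iff B.rightRegular.idem

theorem isInverse_inI_iff {e : I} {p : Idem S} : IsInverse e (B.inI p) ↔ e ∈ B.LClass p := by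
  rw [B.leftRegular.isInverse_iff, mem_LClass]

theorem isInverse_inΛ_iff {f : Λ} {p : Idem S} : IsInverse f (B.inΛ p) ↔ f ∈ B.RClass p := by
  rw [B.rightRegular.isInverse_iff, mem_RClass]

theorem inI_mem (p : Idem S) : B.inI p ∈ B.LClass p :=
  B.mem_LClass.2 ⟨B.leftRegular.idem _, B.leftRegular.idem _⟩

theorem inΛ_mem (p : Idem S) : B.inΛ p ∈ B.RClass p :=
  B.mem_RClass.2 ⟨B.rightRegular.idem _, B.rightRegular.idem _⟩

variable {B}

theorem mul_eq_left_of_mem_LClass {e g : I} {p : Idem S} (he : e ∈ B.LClass p)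
    (hg : g ∈ B.LClass p) : e * g = e := by
  rw [mem_LClass] at he hg
  rw [← he.1, mul_assoc, hg.2]

theorem mul_eq_right_of_mem_RClass {f h : Λ} {p : Idem S} (hf : f ∈ B.RClass p)
    (hh : h ∈ B.RClass p) : f * h = h := by
  rw [mem_RClass] at hf hh
  rw [← hh.1, ← mul_assoc, hf.2]

/-- The hypothesis says `q ≤ p`, so `q e = q p e = q p = q`. With `q = (x y)(x y)⁻¹ ≤ x x⁻¹ = p`
this keeps products of triples inside `W`. -/
theorem mul_mem_LClass {e a : I} {p q : Idem S} (hqp : q * p = q) (he : e ∈ B.LClass p)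
    (ha : a ∈ B.LClass q) : e * a ∈ B.LClass q := by
  rw [mem_LClass] at *
  refine ⟨by rw [mul_assoc, ha.1], ?_⟩
  rw [← hqp, map_mul, mul_assoc, ← mul_assoc _ e, he.2, ← mul_assoc, ← map_mul, hqp, ha.2]

theorem mul_mem_RClass {b f : Λ} {p q : Idem S} (hqp : p * q = q) (hf : f ∈ B.RClass p)
    (hb : b ∈ B.RClass q) : b * f ∈ B.RClass q := by
  rw [mem_RClass] at *
  refine ⟨by rw [← mul_assoc, hb.1], ?_⟩
  rw [← hqp, map_mul, ← mul_assoc, mul_assoc b, hf.2, mul_assoc, ← map_mul, hqp, hb.2]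

namespace IsAdmissible

variable {α : S → S → (Λ × I →. I)} {β : S → S → (Λ × I →. Λ)}

theorem exists_values (h : B.IsAdmissible α β) {x y : S} {f : Λ} {g : I}
    (hf : f ∈ B.RClass (dm x)) (hg : g ∈ B.LClass (rg y)) :
    ∃ ab : I × Λ, ab.1 ∈ α x y (f, g) ∧ ab.2 ∈ β x y (f, g) := by
  -- Only definedness is wanted, so the third factor is arbitrary; `y⁻¹` and the base idempotents
  -- merely fill the slots.
  obtain ⟨a, ha, b, hb, -⟩ := h.assoc x y (sinv y) f hf g hg _ (B.inΛ_mem _) _ (B.inI_mem _)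
  exact ⟨(a, b), ha, hb⟩

/-- The multiplication on `W`. -/
noncomputable def mul (h : B.IsAdmissible α β) (s t : B.W) : B.W where
  e := s.e * (h.exists_values s.f_mem t.e_mem).choose.1
  x := s.x * t.x
  f := (h.exists_values s.f_mem t.e_mem).choose.2 * t.f
  e_mem := mul_mem_LClass (rg_mul_rg _ _) s.e_mem
    (h.α_mem _ _ _ _ (h.exists_values s.f_mem t.e_mem).choose_spec.1)
  f_mem := mul_mem_RClass (dm_mul_dm _ _) t.f_mem
    (h.β_mem _ _ _ _ (h.exists_values s.f_mem t.e_mem).choose_spec.2)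

theorem isProduct_mul (h : B.IsAdmissible α β) : IsProduct α β h.mul := fun s t =>
  ⟨_, (h.exists_values s.f_mem t.e_mem).choose_spec.1, _,
    (h.exists_values s.f_mem t.e_mem).choose_spec.2, rfl, rfl, rfl⟩

theorem mul_eq (h : B.IsAdmissible α β) (s t : B.W) {a : I} {b : Λ}
    (ha : a ∈ α s.x t.x (s.f, t.e)) (hb : b ∈ β s.x t.x (s.f, t.e)) :
    (h.mul s t).e = s.e * a ∧ (h.mul s t).x = s.x * t.x ∧ (h.mul s t).f = b * t.f := by
  obtain ⟨a', ha', b', hb', h1⟩ := h.isProduct_mul s t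
  rwa [Part.mem_unique ha ha', Part.mem_unique hb hb']

/-- The outer coordinates are the two identities of `assoc`, multiplied on the left by `s.e` and on
the right by `r.f`. -/
theorem mul_assoc' (h : B.IsAdmissible α β) (s t r : B.W) :
    h.mul (h.mul s t) r = h.mul s (h.mul t r) := by
  obtain ⟨a, ha, b, hb, a', ha', b', hb', c, hc, d, hd, c', hc', d', hd', h1, h2⟩ :=
    h.assoc s.x t.x r.x s.f s.f_mem t.e t.e_mem t.f t.f_mem r.e r.e_mem
  obtain ⟨e1, x1, f1⟩ := h.mul_eq s t ha hb
  obtain ⟨e2, x2, f2⟩ := h.mul_eq t r ha' hb'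
  obtain ⟨e3, x3, f3⟩ := h.mul_eq (h.mul s t) r (a := c) (b := d)
    (by rwa [x1, f1]) (by rwa [x1, f1])
  obtain ⟨e4, x4, f4⟩ := h.mul_eq s (h.mul t r) (a := c') (b := d')
    (by rwa [x2, e2]) (by rwa [x2, e2])
  ext
  · rw [e3, e4, e1, _root_.mul_assoc, h1]
  · rw [x3, x4, x1, x2, _root_.mul_assoc]
  · rw [f3, f4, f2, ← _root_.mul_assoc, h2]

/-- The semigroup structure on `W`. -/
noncomputable abbrev semigroup (h : B.IsAdmissible α β) : Semigroup B.W where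
  mul := h.mul
  mul_assoc := h.mul_assoc'

end IsAdmissible

/-- The element `(x x⁻¹, x, x⁻¹ x)` of `W⁰`. -/
noncomputable def ofBase (B : BandPair S I Λ) (x : S) : B.W :=
  ⟨B.inI (rg x), x, B.inΛ (dm x), B.inI_mem _, B.inΛ_mem _⟩

theorem mem_W₀_iff {s : B.W} : s ∈ B.W₀ ↔ s = B.ofBase s.x :=
  ⟨fun h => W.ext h.1 rfl h.2, fun h => ⟨congrArg W.e h, congrArg W.f h⟩⟩

theorem ofBase_mem (x : S) : B.ofBase x ∈ B.W₀ := ⟨rfl, rfl⟩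

end BandPair

/-! ### Orthodoxy of `W` and the transversal `W⁰` -/

namespace BandPair

variable {S : Type u} {I : Type v} {Λ : Type w} [Semigroup S] [IsInverseSemigroup S]
  [Semigroup I] [Semigroup Λ] {B : BandPair S I Λ}

namespace IsAdmissible

variable {α : S → S → (Λ × I →. I)} {β : S → S → (Λ × I →. Λ)}

theorem mul_e_eq (h : B.IsAdmissible α β) {s t : B.W} (hx : rg (s.x * t.x) = rg s.x) :
    (h.mul s t).e = s.e := by
  obtain ⟨a, ha, b, hb, he, -, -⟩ := h.isProduct_mul s t
  rw [he]
  exact mul_eq_left_of_mem_LClass s.e_mem (hx ▸ h.α_mem _ _ _ _ ha)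

theorem mul_f_eq (h : B.IsAdmissible α β) {s t : B.W} (hx : dm (s.x * t.x) = dm t.x) :
    (h.mul s t).f = t.f := by
  obtain ⟨a, ha, b, hb, -, -, hf⟩ := h.isProduct_mul s t
  rw [hf]
  exact mul_eq_right_of_mem_RClass (hx ▸ h.β_mem _ _ _ _ hb) t.f_mem

/-- Absorption reduces idempotency to the middle coordinate, so closure of idempotents is inherited
from the inverse semigroup. -/
theorem mul_self_eq_iff (h : B.IsAdmissible α β) {s : B.W} :
    h.mul s s = s ↔ s.x * s.x = s.x := by
  constructor
  · intro hs
    exact congrArg W.x hs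
  · intro hs
    exact W.ext (h.mul_e_eq (by rw [hs])) hs (h.mul_f_eq (by rw [hs]))

theorem ofBase_mul (h : B.IsAdmissible α β) (x y : S) :
    h.mul (B.ofBase x) (B.ofBase y) = B.ofBase (x * y) := by
  obtain ⟨e, -, f⟩ := h.mul_eq (B.ofBase x) (B.ofBase y) (h.α_base x y) (h.β_base x y)
  refine W.ext ?_ rfl ?_
  · rw [e]
    change B.inI (rg x) * B.inI (rg (x * y)) = B.inI (rg (x * y))
    rw [← map_mul, idem_mul_comm, rg_mul_rg]
  · rw [f]
    change B.inΛ (dm (x * y)) * B.inΛ (dm y) = B.inΛ (dm (x * y))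
    rw [← map_mul, idem_mul_comm, dm_mul_dm]

theorem mul_ofBase_sinv (h : B.IsAdmissible α β) (s : B.W) :
    (h.mul s (B.ofBase (sinv s.x))).e = s.e ∧
      (h.mul s (B.ofBase (sinv s.x))).x = s.x * sinv s.x ∧
      (h.mul s (B.ofBase (sinv s.x))).f = B.inΛ (rg s.x) := by
  refine ⟨h.mul_e_eq (rg_idem (rg s.x)), rfl, ?_⟩
  rw [← dm_sinv s.x]
  exact h.mul_f_eq ((dm_idem (rg s.x)).trans (dm_sinv s.x).symm)

theorem ofBase_sinv_mul (h : B.IsAdmissible α β) (s : B.W) :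
    (h.mul (B.ofBase (sinv s.x)) s).e = B.inI (dm s.x) ∧
      (h.mul (B.ofBase (sinv s.x)) s).x = sinv s.x * s.x ∧
      (h.mul (B.ofBase (sinv s.x)) s).f = s.f := by
  refine ⟨?_, rfl, h.mul_f_eq (dm_idem (dm s.x))⟩
  rw [← rg_sinv s.x]
  exact h.mul_e_eq ((rg_idem (dm s.x)).trans (rg_sinv s.x).symm)

theorem isInverse_ofBase (h : B.IsAdmissible α β) (s : B.W) :
    @IsInverse B.W h.semigroup s (B.ofBase (sinv s.x)) := by
  obtain ⟨e1, x1, f1⟩ := h.mul_ofBase_sinv s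
  obtain ⟨e2, x2, f2⟩ := h.ofBase_sinv_mul s
  have i1 := (isInverse_sinv s.x).1
  have i2 := (isInverse_sinv s.x).2
  constructor
  · change h.mul (h.mul s (B.ofBase (sinv s.x))) s = s
    refine W.ext ?_ i1 ?_
    · rw [h.mul_e_eq, e1]
      rw [x1, i1]
      exact (rg_idem (rg s.x)).symm
    · rw [h.mul_f_eq]
      rw [x1, i1]
  · change h.mul (h.mul (B.ofBase (sinv s.x)) s) (B.ofBase (sinv s.x)) = B.ofBase (sinv s.x)
    refine W.ext ?_ i2 ?_
    · rw [h.mul_e_eq, e2, ← rg_sinv]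
      · rfl
      · rw [x2]
        change rg (sinv s.x * s.x * sinv s.x) = _
        rw [i2, rg_sinv]
        exact (rg_idem (dm s.x)).symm
    · rw [h.mul_f_eq]
      rw [x2]
      change dm (sinv s.x * s.x * sinv s.x) = dm (sinv s.x)
      rw [i2]

theorem isOrthodox (h : B.IsAdmissible α β) : @IsOrthodox B.W h.semigroup := by
  let := h.semigroup
  refine ⟨fun s => ⟨_, (h.isInverse_ofBase s).1⟩, fun s t hs ht => ?_⟩
  exact h.mul_self_eq_iff.2 (isIdempotentElem_mul_of_inverse
    (h.mul_self_eq_iff.1 hs) (h.mul_self_eq_iff.1 ht))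

/-- `W⁰` as a subsemigroup of `W`. -/
noncomputable def base (h : B.IsAdmissible α β) : @Subsemigroup B.W h.semigroup.toMul :=
  letI := h.semigroup
  { carrier := B.W₀
    mul_mem' := fun {s t} hs ht => by
      rw [mem_W₀_iff] at hs ht
      rw [hs, ht]
      change h.mul _ _ ∈ _
      rw [h.ofBase_mul]
      exact ofBase_mem _ }

/-- The middle coordinate is a homomorphism, so it sends inverses to inverses, and an element of
`W⁰` is determined by it. -/
theorem eq_ofBase_of_isInverse (h : B.IsAdmissible α β) {s t : B.W} (ht : t ∈ B.W₀)
    (hst : @IsInverse B.W h.semigroup s t) : t = B.ofBase (sinv s.x) := by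
  rw [mem_W₀_iff.1 ht]
  congr 1
  exact (sinv_eq ⟨congrArg W.x hst.1, congrArg W.x hst.2⟩).symm

theorem isInverseTransversal_base (h : B.IsAdmissible α β) :
    @IsInverseTransversal B.W h.semigroup h.base := by
  let := h.semigroup
  refine ⟨h.isOrthodox.regular, ⟨fun s => ?_⟩, fun s => ?_⟩
  · obtain ⟨h1, h2⟩ := h.isInverse_ofBase s.1
    refine ⟨⟨B.ofBase (sinv s.1.x), ofBase_mem _⟩, ⟨Subtype.ext h1, Subtype.ext h2⟩, ?_⟩
    rintro ⟨t, ht⟩ ⟨h3, h4⟩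
    exact Subtype.ext (h.eq_ofBase_of_isInverse ht
      ⟨congrArg Subtype.val h3, congrArg Subtype.val h4⟩)
  · exact ⟨_, ⟨ofBase_mem _, h.isInverse_ofBase s⟩,
      fun t ht => h.eq_ofBase_of_isInverse ht.1 ht.2⟩

/-- `W⁰` is isomorphic to the given inverse semigroup. -/
noncomputable def baseEquiv (h : B.IsAdmissible α β) :
    letI := h.semigroup
    h.base ≃* S :=
  letI := h.semigroup
  { toFun := fun s => s.1.x
    invFun := fun x => ⟨B.ofBase x, ofBase_mem x⟩
    left_inv := fun s => Subtype.ext (mem_W₀_iff.1 s.2).symm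
    right_inv := fun _ => rfl
    map_mul' := fun _ _ => rfl }

/-! ### The bands of `W` under condition (4) -/

theorem mem_ISet_iff (h : B.IsAdmissible α β) {s : B.W} :
    s ∈ @ISet B.W h.semigroup h.base ↔
      IsIdempotentElem s.x ∧ s.f = B.inΛ (dm s.x) := by
  let := h.semigroup
  constructor
  · rintro ⟨z, y, hy, hzy, rfl⟩
    rw [h.eq_ofBase_of_isInverse hy hzy]
    refine ⟨(rg z.x).2, ?_⟩
    exact (h.mul_ofBase_sinv z).2.2.trans (congrArg B.inΛ (dm_idem (rg z.x)).symm)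
  · rintro ⟨hx, hf⟩
    refine ⟨s, _, ofBase_mem _, h.isInverse_ofBase s, ?_⟩
    obtain ⟨e1, x1, f1⟩ := h.mul_ofBase_sinv s
    have hs : sinv s.x = s.x := sinv_eq hx.isInverse_self
    refine W.ext e1.symm (x1.trans (by rw [hs, hx.eq])).symm (hf.trans (Eq.trans ?_ f1.symm))
    rw [← rg_sinv, hs]

theorem mem_LambdaSet_iff (h : B.IsAdmissible α β) {s : B.W} :
    s ∈ @LambdaSet B.W h.semigroup h.base ↔
      IsIdempotentElem s.x ∧ s.e = B.inI (rg s.x) := by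
  let := h.semigroup
  constructor
  · rintro ⟨z, y, hy, hzy, rfl⟩
    rw [h.eq_ofBase_of_isInverse hy hzy]
    refine ⟨(dm z.x).2, ?_⟩
    exact (h.ofBase_sinv_mul z).1.trans (congrArg B.inI (rg_idem (dm z.x)).symm)
  · rintro ⟨hx, he⟩
    refine ⟨s, _, ofBase_mem _, h.isInverse_ofBase s, ?_⟩
    obtain ⟨e1, x1, f1⟩ := h.ofBase_sinv_mul s
    have hs : sinv s.x = s.x := sinv_eq hx.isInverse_self
    refine W.ext (he.trans (Eq.trans ?_ e1.symm)) (x1.trans (by rw [hs, hx.eq])).symm f1.symm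
    rw [← dm_sinv, hs]

theorem coe_rg_of_idem {x : S} (hx : IsIdempotentElem x) : (rg x : S) = x := by
  change x * sinv x = x
  rw [sinv_eq hx.isInverse_self, hx.eq]

theorem dm_eq_rg_of_idem {x : S} (hx : IsIdempotentElem x) : dm x = rg x := by
  rw [← rg_sinv, sinv_eq hx.isInverse_self]

theorem nonempty_ISubsemigroup_mulEquiv (h : B.IsAdmissible α β) (hc : B.IsCompatible α β) :
    letI := h.semigroup
    Nonempty (h.isInverseTransversal_base.ISubsemigroup h.isOrthodox ≃* I) := by
  let := h.semigroup
  let φ : h.isInverseTransversal_base.ISubsemigroup h.isOrthodox →ₙ* I :=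
    { toFun := fun s => s.1.e
      map_mul' := fun s t => by
        obtain ⟨hs, hsf⟩ := h.mem_ISet_iff.1 s.2
        obtain ⟨ht, -⟩ := h.mem_ISet_iff.1 t.2
        -- The first half of (4) involves `f` only through `f⁰`, so it is applied to `f = f⁰`. The
        -- product then has first coordinate `e (e⁰ g) = e g`.
        have h1 := (hc (B.inΛ (rg s.1.x)) t.1.e (rg s.1.x) (rg t.1.x)
          (B.isInverse_inΛ_iff.2 (B.inΛ_mem _)) (B.isInverse_inI_iff.2 t.1.e_mem)).1
        rw [coe_rg_of_idem hs, coe_rg_of_idem ht, ← dm_eq_rg_of_idem hs, ← hsf] at h1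
        obtain ⟨a, ha, b, hb, he, -, -⟩ := h.isProduct_mul s.1 t.1
        rw [Part.mem_unique ha h1, dm_eq_rg_of_idem hs, ← mul_assoc,
          (B.mem_LClass.1 s.1.e_mem).1] at he
        exact he }
  refine ⟨MulEquiv.ofBijective φ ⟨fun s t hst => ?_, fun e => ?_⟩⟩
  · obtain ⟨hs, hsf⟩ := h.mem_ISet_iff.1 s.2
    obtain ⟨ht, htf⟩ := h.mem_ISet_iff.1 t.2
    have he : s.1.e = t.1.e := hst
    -- The idempotent middle entry is recovered from `e` as its unique inverse in `E⁰`, and the last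
    -- coordinate is determined by it.
    have hr : rg s.1.x = rg t.1.x := (B.transversalI s.1.e).unique
      (B.isInverse_inI_iff.2 s.1.e_mem) (B.isInverse_inI_iff.2 (he ▸ t.1.e_mem))
    have hx : s.1.x = t.1.x := by rw [← coe_rg_of_idem hs, hr, coe_rg_of_idem ht]
    exact Subtype.ext (W.ext he hx (by rw [hsf, htf, hx]))
  · obtain ⟨p, hp, -⟩ := B.transversalI e
    exact ⟨⟨⟨e, p, B.inΛ (dm p), by rw [rg_idem]; exact B.isInverse_inI_iff.1 hp, B.inΛ_mem _⟩,
      h.mem_ISet_iff.2 ⟨p.2, rfl⟩⟩, rfl⟩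

theorem nonempty_LambdaSubsemigroup_mulEquiv (h : B.IsAdmissible α β)
    (hc : B.IsCompatible α β) :
    letI := h.semigroup
    Nonempty (h.isInverseTransversal_base.LambdaSubsemigroup h.isOrthodox ≃* Λ) := by
  let := h.semigroup
  let φ : h.isInverseTransversal_base.LambdaSubsemigroup h.isOrthodox →ₙ* Λ :=
    { toFun := fun s => s.1.f
      map_mul' := fun s t => by
        obtain ⟨hs, -⟩ := h.mem_LambdaSet_iff.1 s.2
        obtain ⟨ht, hte⟩ := h.mem_LambdaSet_iff.1 t.2
        have h1 := (hc s.1.f (B.inI (rg t.1.x)) (rg s.1.x) (rg t.1.x)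
          (B.isInverse_inΛ_iff.2 (dm_eq_rg_of_idem hs ▸ s.1.f_mem))
          (B.isInverse_inI_iff.2 (B.inI_mem _))).2
        rw [coe_rg_of_idem hs, coe_rg_of_idem ht, ← hte, ← dm_eq_rg_of_idem ht] at h1
        obtain ⟨a, ha, b, hb, -, -, hf⟩ := h.isProduct_mul s.1 t.1
        rw [Part.mem_unique hb h1, mul_assoc, (B.mem_RClass.1 t.1.f_mem).1] at hf
        exact hf }
  refine ⟨MulEquiv.ofBijective φ ⟨fun s t hst => ?_, fun f => ?_⟩⟩
  · obtain ⟨hs, hse⟩ := h.mem_LambdaSet_iff.1 s.2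
    obtain ⟨ht, hte⟩ := h.mem_LambdaSet_iff.1 t.2
    have hf : s.1.f = t.1.f := hst
    have hr : dm s.1.x = dm t.1.x := (B.transversalΛ s.1.f).unique
      (B.isInverse_inΛ_iff.2 s.1.f_mem) (B.isInverse_inΛ_iff.2 (hf ▸ t.1.f_mem))
    have hx : s.1.x = t.1.x := by
      rw [← coe_rg_of_idem hs, ← dm_eq_rg_of_idem hs, hr, dm_eq_rg_of_idem ht, coe_rg_of_idem ht]
    exact Subtype.ext (W.ext (by rw [hse, hte, hx]) hx hf)
  · obtain ⟨p, hp, -⟩ := B.transversalΛ f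
    exact ⟨⟨⟨B.inI (rg p), p, f, B.inI_mem _, by rw [dm_idem]; exact B.isInverse_inΛ_iff.1 hp⟩,
      h.mem_LambdaSet_iff.2 ⟨p.2, rfl⟩⟩, rfl⟩

end IsAdmissible
end BandPair

/-! ### The converse: coordinates on an orthodox semigroup -/

namespace IsInverseTransversal

variable {S : Type u} [Semigroup S] {T : Subsemigroup S} [IsInverseSemigroup T]

theorem coe_sinv_mul (x y : T) : ((sinv (x * y) : T) : S) = ((sinv y : T) : S) * ((sinv x : T) : S) :=
  congrArg Subtype.val (sinv_mul x y)

theorem coe_isInverse_sinv (x : T) : IsInverse (x : S) ((sinv x : T) : S) :=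
  ⟨congrArg Subtype.val (isInverse_sinv x).1, congrArg Subtype.val (isInverse_sinv x).2⟩

theorem coe_idem (p : Idem T) : ((p : T) : S) * ((p : T) : S) = ((p : T) : S) :=
  congrArg Subtype.val p.2.eq

theorem coe_rg (x : T) : ((rg x : T) : S) = x * (sinv x : T) := rfl

theorem coe_dm (x : T) : ((dm x : T) : S) = (sinv x : T) * x := rfl

/-- An idempotent of a subsemigroup, from an idempotent of the ambient semigroup. -/
def toIdem {p : S} (hpT : p ∈ T) (hp : IsIdempotentElem p) : Idem T :=
  ⟨⟨p, hpT⟩, Subtype.ext hp⟩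

variable (hT : IsInverseTransversal T) (hS : IsOrthodox S)

include hT in
theorem coe_idem_mem_ISet (p : Idem T) : ((p : T) : S) ∈ ISet T :=
  hT.mem_ISet_iff.2 ⟨_, p.1.2, coe_idem p, coe_idem p, coe_idem p⟩

include hT in
theorem coe_idem_mem_LambdaSet (p : Idem T) : ((p : T) : S) ∈ LambdaSet T :=
  hT.mem_LambdaSet_iff.2 ⟨_, p.1.2, coe_idem p, coe_idem p, coe_idem p⟩

/-- The bands `I(S)` and `Λ(S)` of an orthodox semigroup with an inverse transversal. -/
def bandPair : BandPair T (hT.ISubsemigroup hS) (hT.LambdaSubsemigroup hS) where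
  leftRegular := hT.isLeftRegularBand hS
  rightRegular := hT.isRightRegularBand hS
  inI :=
    { toFun := fun p => ⟨p.1, hT.coe_idem_mem_ISet p⟩
      map_mul' := fun _ _ => rfl }
  inΛ :=
    { toFun := fun p => ⟨p.1, hT.coe_idem_mem_LambdaSet p⟩
      map_mul' := fun _ _ => rfl }
  inI_injective := fun _ _ h => Subtype.ext (Subtype.ext (Subtype.mk.inj h))
  inΛ_injective := fun _ _ h => Subtype.ext (Subtype.ext (Subtype.mk.inj h))
  transversalI := by
    rintro ⟨e, he⟩
    obtain ⟨p, hpT, hp, h1, h2⟩ := hT.mem_ISet_iff.1 he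
    refine ⟨toIdem hpT hp, (hT.isLeftRegularBand hS).isInverse_iff.2
      ⟨Subtype.ext h1, Subtype.ext h2⟩, fun q hq => ?_⟩
    refine Subtype.ext (Subtype.ext ((hT.existsUnique_mem e).unique
      ⟨q.1.2, congrArg Subtype.val hq.1, congrArg Subtype.val hq.2⟩ ⟨hpT, ?_, ?_⟩))
    · change e * p * e = e
      exact h1.symm ▸ congrArg Subtype.val ((hT.isLeftRegularBand hS).idem ⟨e, he⟩)
    · change p * e * p = p
      rw [h2, hp.eq]
  transversalΛ := by
    rintro ⟨f, hf⟩
    obtain ⟨p, hpT, hp, h1, h2⟩ := hT.mem_LambdaSet_iff.1 hf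
    refine ⟨toIdem hpT hp, (hT.isRightRegularBand hS).isInverse_iff.2
      ⟨Subtype.ext h1, Subtype.ext h2⟩, fun q hq => ?_⟩
    refine Subtype.ext (Subtype.ext ((hT.existsUnique_mem f).unique
      ⟨q.1.2, congrArg Subtype.val hq.1, congrArg Subtype.val hq.2⟩ ⟨hpT, ?_, ?_⟩))
    · change f * p * f = f
      rw [mul_assoc, h1]
      exact congrArg Subtype.val ((hT.isRightRegularBand hS).idem ⟨f, hf⟩)
    · change p * f * p = p
      rw [h1, h2]

variable {hT hS}

theorem mem_LClass_iff {e : hT.ISubsemigroup hS} {p : Idem T} :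
    e ∈ (hT.bandPair hS).LClass p ↔
      (e : S) * (p : T) = e ∧ ((p : T) : S) * e = (p : T) := by
  rw [BandPair.mem_LClass, Subtype.ext_iff, Subtype.ext_iff]
  rfl

theorem mem_RClass_iff {f : hT.LambdaSubsemigroup hS} {p : Idem T} :
    f ∈ (hT.bandPair hS).RClass p ↔
      ((p : T) : S) * f = f ∧ (f : S) * (p : T) = (p : T) := by
  rw [BandPair.mem_RClass, Subtype.ext_iff, Subtype.ext_iff]
  rfl

/-- Here `u` plays the role of `s⁰⁰`, so that `s s⁰` is a legitimate first coordinate over the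
middle entry `s⁰⁰`. -/
theorem mul_sinv_mem_LClass {s : S} {u : T} (h : IsInverse s ((sinv u : T) : S)) :
    (⟨s * sinv u, s, _, (sinv u).2, h, rfl⟩ : hT.ISubsemigroup hS) ∈
      (hT.bandPair hS).LClass (rg u) := by
  rw [mem_LClass_iff, coe_rg]
  obtain ⟨h1, h2⟩ := h
  obtain ⟨h3, h4⟩ := coe_isInverse_sinv u
  grind [mul_assoc]

theorem sinv_mul_mem_RClass {s : S} {u : T} (h : IsInverse s ((sinv u : T) : S)) :
    (⟨sinv u * s, s, _, (sinv u).2, h, rfl⟩ : hT.LambdaSubsemigroup hS) ∈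
      (hT.bandPair hS).RClass (dm u) := by
  rw [mem_RClass_iff, coe_dm]
  obtain ⟨h1, h2⟩ := h
  obtain ⟨h3, h4⟩ := coe_isInverse_sinv u
  grind [mul_assoc]

theorem isInverse_mul_of_mem_RClass {x : T} {f : hT.LambdaSubsemigroup hS}
    (hf : f ∈ (hT.bandPair hS).RClass (dm x)) : IsInverse ((x : S) * f) ((sinv x : T) : S) := by
  rw [mem_RClass_iff, coe_dm] at hf
  obtain ⟨h1, h2⟩ := hf
  obtain ⟨h3, h4⟩ := coe_isInverse_sinv x
  constructor <;> grind [mul_assoc]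

theorem isInverse_mul_of_mem_LClass {y : T} {g : hT.ISubsemigroup hS}
    (hg : g ∈ (hT.bandPair hS).LClass (rg y)) : IsInverse ((g : S) * y) ((sinv y : T) : S) := by
  rw [mem_LClass_iff, coe_rg] at hg
  obtain ⟨h1, h2⟩ := hg
  obtain ⟨h3, h4⟩ := coe_isInverse_sinv y
  constructor <;> grind [mul_assoc]

/-- The factors `x f` and `g y` have inverses `x⁻¹` and `y⁻¹`; orthodoxy multiplies them. This is
what puts the values of `α` and `β` in `I(S)` and `Λ(S)`. -/
theorem isInverse_middle {x y : T} {f : hT.LambdaSubsemigroup hS} {g : hT.ISubsemigroup hS}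
    (hf : f ∈ (hT.bandPair hS).RClass (dm x)) (hg : g ∈ (hT.bandPair hS).LClass (rg y)) :
    IsInverse ((x : S) * f * (g * y)) ((sinv (x * y) : T) : S) := by
  rw [coe_sinv_mul]
  exact (isInverse_mul_of_mem_RClass hf).mul hS.idem_mul (isInverse_mul_of_mem_LClass hg)

theorem isInverse_triple {x : T} {e : hT.ISubsemigroup hS} {f : hT.LambdaSubsemigroup hS}
    (he : e ∈ (hT.bandPair hS).LClass (rg x)) (hf : f ∈ (hT.bandPair hS).RClass (dm x)) :
    IsInverse ((e : S) * x * f) ((sinv x : T) : S) := by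
  rw [mem_LClass_iff, coe_rg] at he
  rw [mem_RClass_iff, coe_dm] at hf
  obtain ⟨h1, h2⟩ := hf
  obtain ⟨h5, h6⟩ := he
  obtain ⟨h3, h4⟩ := coe_isInverse_sinv x
  constructor <;> grind [mul_assoc]

variable (hT hS)

/-- The partial maps `(f, g) α_{x, y} = x f g y (x y)⁻¹`. -/
noncomputable def α (x y : T) : hT.LambdaSubsemigroup hS × hT.ISubsemigroup hS →.
    hT.ISubsemigroup hS := fun p =>
  ⟨p.1 ∈ (hT.bandPair hS).RClass (dm x) ∧ p.2 ∈ (hT.bandPair hS).LClass (rg y),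
    fun h => ⟨(x : S) * p.1 * (p.2 * y) * sinv (x * y), _, _, (sinv (x * y)).2,
      isInverse_middle h.1 h.2, rfl⟩⟩

/-- The partial maps `(f, g) β_{x, y} = (x y)⁻¹ x f g y`. -/
noncomputable def β (x y : T) : hT.LambdaSubsemigroup hS × hT.ISubsemigroup hS →.
    hT.LambdaSubsemigroup hS := fun p =>
  ⟨p.1 ∈ (hT.bandPair hS).RClass (dm x) ∧ p.2 ∈ (hT.bandPair hS).LClass (rg y),
    fun h => ⟨sinv (x * y) * ((x : S) * p.1 * (p.2 * y)), _, _, (sinv (x * y)).2,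
      isInverse_middle h.1 h.2, rfl⟩⟩

variable {hT hS}

theorem mem_α {x y : T} {f : hT.LambdaSubsemigroup hS} {g a : hT.ISubsemigroup hS} :
    a ∈ hT.α hS x y (f, g) ↔
      (f ∈ (hT.bandPair hS).RClass (dm x) ∧ g ∈ (hT.bandPair hS).LClass (rg y)) ∧
        (a : S) = (x : S) * f * (g * y) * sinv (x * y) := by
  constructor
  · rintro ⟨h, rfl⟩
    exact ⟨h, rfl⟩
  · rintro ⟨h, ha⟩
    exact ⟨h, Subtype.ext ha.symm⟩

theorem mem_β {x y : T} {f b : hT.LambdaSubsemigroup hS} {g : hT.ISubsemigroup hS} :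
    b ∈ hT.β hS x y (f, g) ↔
      (f ∈ (hT.bandPair hS).RClass (dm x) ∧ g ∈ (hT.bandPair hS).LClass (rg y)) ∧
        (b : S) = sinv (x * y) * ((x : S) * f * (g * y)) := by
  constructor
  · rintro ⟨h, rfl⟩
    exact ⟨h, rfl⟩
  · rintro ⟨h, ha⟩
    exact ⟨h, Subtype.ext ha.symm⟩

theorem mem_LClass_of_mem_α {x y : T}
    {p : hT.LambdaSubsemigroup hS × hT.ISubsemigroup hS} {a : hT.ISubsemigroup hS}
    (ha : a ∈ hT.α hS x y p) : a ∈ (hT.bandPair hS).LClass (rg (x * y)) := by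
  obtain ⟨h, rfl⟩ := ha
  exact mul_sinv_mem_LClass (isInverse_middle h.1 h.2)

theorem mem_RClass_of_mem_β {x y : T}
    {p : hT.LambdaSubsemigroup hS × hT.ISubsemigroup hS} {b : hT.LambdaSubsemigroup hS}
    (hb : b ∈ hT.β hS x y p) : b ∈ (hT.bandPair hS).RClass (dm (x * y)) := by
  obtain ⟨h, rfl⟩ := hb
  exact sinv_mul_mem_RClass (isInverse_middle h.1 h.2)

theorem exists_values {x y : T} {f : hT.LambdaSubsemigroup hS} {g : hT.ISubsemigroup hS}
    (hf : f ∈ (hT.bandPair hS).RClass (dm x)) (hg : g ∈ (hT.bandPair hS).LClass (rg y)) :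
    ∃ a ∈ hT.α hS x y (f, g), ∃ b ∈ hT.β hS x y (f, g),
      (a : S) = (x : S) * f * (g * y) * sinv (x * y) ∧
      (b : S) = sinv (x * y) * ((x : S) * f * (g * y)) :=
  ⟨_, ⟨⟨hf, hg⟩, rfl⟩, _, ⟨⟨hf, hg⟩, rfl⟩, rfl, rfl⟩

variable (hT hS)

theorem isAdmissible : (hT.bandPair hS).IsAdmissible (hT.α hS) (hT.β hS) where
  dom_eq _ _ := rfl
  dom_subset _ _ _ h := h
  α_mem _ _ _ _ := mem_LClass_of_mem_α
  β_mem _ _ _ _ := mem_RClass_of_mem_β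
  assoc x y z f hf g hg h hh k hk := by
    obtain ⟨a, ha, b, hb, ea, eb⟩ := exists_values hf hg
    obtain ⟨a', ha', b', hb', ea', eb'⟩ := exists_values hh hk
    obtain ⟨c, hc, d, hd, ec, ed⟩ := exists_values (x := x * y)
      (BandPair.mul_mem_RClass (dm_mul_dm x y) hh (mem_RClass_of_mem_β hb)) hk
    obtain ⟨c', hc', d', hd', ec', ed'⟩ := exists_values (y := y * z) hf
      (BandPair.mul_mem_LClass (rg_mul_rg y z) hg (mem_LClass_of_mem_α ha'))
    refine ⟨a, ha, b, hb, a', ha', b', hb', c, hc, d, hd, c', hc', d', hd', ?_, ?_⟩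
    -- Both sides reduce to `x f g y h k z (x y z)⁻¹`: on the left by `u (x y)⁻¹ u = u` for `u = x f
    -- g y`, on the right by splitting off `(y z)⁻¹` from `(x y z)⁻¹` to cancel `(y z)⁻¹ (y z)`.
    · refine Subtype.ext ?_
      obtain ⟨h1, -⟩ := isInverse_middle hf hg
      have h2 := (coe_isInverse_sinv (x * y)).2
      have h3 := (coe_isInverse_sinv (y * z)).2
      rw [MulMemClass.coe_mul] at h2 h3
      have h4 : ((sinv (x * y * z) : T) : S) = ((sinv (y * z) : T) : S) * ((sinv x : T) : S) := by
        rw [mul_assoc, coe_sinv_mul]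
      have h5 : ((sinv (x * (y * z)) : T) : S) = ((sinv (y * z) : T) : S) * ((sinv x : T) : S) := coe_sinv_mul _ _
      simp only [MulMemClass.coe_mul] at *
      grind [mul_assoc]
    -- Dually, both sides reduce to `(x y z)⁻¹ x f g y h k z`, now with `(x y z)⁻¹ = z⁻¹ (x y)⁻¹`.
    · refine Subtype.ext ?_
      obtain ⟨h1, -⟩ := isInverse_middle hh hk
      have h2 := (coe_isInverse_sinv (x * y)).2
      have h3 := (coe_isInverse_sinv (y * z)).2
      rw [MulMemClass.coe_mul] at h2 h3
      have h4 : ((sinv (x * y * z) : T) : S) = ((sinv z : T) : S) * ((sinv (x * y) : T) : S) := coe_sinv_mul _ _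
      have h5 : ((sinv (x * (y * z)) : T) : S) = ((sinv z : T) : S) * ((sinv (x * y) : T) : S) := by
        rw [← mul_assoc, coe_sinv_mul]
      simp only [MulMemClass.coe_mul] at *
      grind [mul_assoc]
  α_base x y := by
    refine mem_α.2 ⟨⟨BandPair.inΛ_mem _ _, BandPair.inI_mem _ _⟩, ?_⟩
    change (x : S) * y * sinv (x * y) = x * (sinv x * x) * (y * sinv y * y) * sinv (x * y)
    have h1 := (coe_isInverse_sinv x).1
    have h2 := (coe_isInverse_sinv y).1
    grind [mul_assoc]
  β_base x y := by
    refine mem_β.2 ⟨⟨BandPair.inΛ_mem _ _, BandPair.inI_mem _ _⟩, ?_⟩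
    change sinv (x * y) * ((x : S) * y) =
      sinv (x * y) * (x * (sinv x * x) * (y * sinv y * y))
    have h1 := (coe_isInverse_sinv x).1
    have h2 := (coe_isInverse_sinv y).1
    grind [mul_assoc]

theorem isCompatible : (hT.bandPair hS).IsCompatible (hT.α hS) (hT.β hS) := by
  intro f e p q hf he
  rw [BandPair.isInverse_inΛ_iff] at hf
  rw [BandPair.isInverse_inI_iff] at he
  have hpq : ((sinv ((p : T) * (q : T)) : T) : S) = p * q :=
    congrArg Subtype.val (sinv_eq (p * q).2.isInverse_self)
  have hf' := mem_RClass_iff.1 hf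
  have he' := mem_LClass_iff.1 he
  have hp := coe_idem p
  have hq := coe_idem q
  constructor
  · refine mem_α.2 ⟨⟨?_, ?_⟩, ?_⟩
    · rw [dm_idem]; exact BandPair.inΛ_mem _ _
    · rwa [rg_idem]
    -- Since `p q` is its own inverse, the value is `p e (p q)`, and `p q` is a right identity for
    -- `p e`.
    · have h := (hT.ISet_aux hS p.1.2 hp hp hp q.1.2 hq he'.1 he'.2).1
      rw [hpq]
      change ((p : T) : S) * e = p * p * (e * q) * (p * q)
      rw [he'.1, hp, h]
  · refine mem_β.2 ⟨⟨?_, ?_⟩, ?_⟩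
    · rwa [dm_idem]
    · rw [rg_idem]; exact BandPair.inI_mem _ _
    · have h := (hT.LambdaSet_aux hS p.1.2 hp hf'.1 hf'.2 q.1.2 hq hq hq).1
      rw [hpq]
      change (f : S) * q = p * q * (p * f * (q * q))
      rw [hf'.1, hq, h]

/-- The isomorphism `(e, x, f) ↦ e x f` from `W` onto the given orthodox semigroup. -/
noncomputable def wEquiv :
    letI := (hT.isAdmissible hS).semigroup
    (hT.bandPair hS).W ≃* S :=
  letI := (hT.isAdmissible hS).semigroup
  MulEquiv.ofBijective
    ({ toFun := fun s => (s.e : S) * s.x * s.f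
       map_mul' := fun s t => by
        obtain ⟨a, ha, b, hb, ea, eb⟩ := exists_values s.f_mem t.e_mem
        obtain ⟨h1, h2, h3⟩ := (hT.isAdmissible hS).mul_eq s t ha hb
        change (((hT.isAdmissible hS).mul s t).e : S) * ((hT.isAdmissible hS).mul s t).x *
          ((hT.isAdmissible hS).mul s t).f = _
        rw [h1, h2, h3]
        have h4 := (isInverse_middle s.f_mem t.e_mem).1
        -- With `u = x f g y`, the middle of the product is `u (x y)⁻¹ (x y) (x y)⁻¹ u = u (x y)⁻¹ u
        -- = u`.
        have h5 := (coe_isInverse_sinv (s.x * t.x)).2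
        simp only [MulMemClass.coe_mul] at *
        grind [mul_assoc] } : (hT.bandPair hS).W →ₙ* S)
    (by
      constructor
      · intro s t hst
        change (s.e : S) * s.x * s.f = t.e * t.x * t.f at hst
        have hs := isInverse_triple s.e_mem s.f_mem
        have ht := isInverse_triple t.e_mem t.f_mem
        -- The inverse of `e x f` in the transversal is `x⁻¹`, so the product determines `x`.
        have hx : s.x = t.x := by
          rw [← sinv_sinv s.x, ← sinv_sinv t.x]
          exact congrArg sinv (Subtype.ext ((hT.existsUnique_mem _).unique
            ⟨(sinv s.x).2, hs⟩ ⟨(sinv t.x).2, hst ▸ ht⟩))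
        -- Once `x` is known, `e` and `f` are recovered from the product by multiplying by `x⁻¹` on
        -- either side.
        have key : ∀ r : (hT.bandPair hS).W, (r.e : S) = r.e * r.x * r.f * sinv r.x ∧
            (r.f : S) = sinv r.x * (r.e * r.x * r.f) := by
          intro r
          have he := mem_LClass_iff.1 r.e_mem
          have hf := mem_RClass_iff.1 r.f_mem
          rw [coe_rg] at he
          rw [coe_dm] at hf
          have h1 := coe_isInverse_sinv r.x
          obtain ⟨h2, h3⟩ := h1
          constructor <;> grind [mul_assoc]
        refine BandPair.W.ext (Subtype.ext ?_) hx (Subtype.ext ?_)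
        · rw [(key s).1, (key t).1, hst, hx]
        · rw [(key s).2, (key t).2, hst, hx]
      · intro s
        obtain ⟨z, ⟨hz, hsz⟩, -⟩ := hT.existsUnique_mem s
        have hu : ((sinv (sinv ⟨z, hz⟩ : T) : T) : S) = z := congrArg Subtype.val (sinv_sinv _)
        have h : IsInverse s ((sinv (sinv ⟨z, hz⟩ : T) : T) : S) := by rwa [hu]
        -- With `z = s⁰`, the preimage is `(s s⁰, s⁰⁰, s⁰ s)`.
        refine ⟨⟨_, sinv ⟨z, hz⟩, _, mul_sinv_mem_LClass h, sinv_mul_mem_RClass h⟩, ?_⟩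
        have h1 := (coe_isInverse_sinv (⟨z, hz⟩ : T)).1
        change s * sinv (sinv (⟨z, hz⟩ : T)) * sinv (⟨z, hz⟩ : T) *
          (sinv (sinv (⟨z, hz⟩ : T)) * s) = s
        rw [hu]
        have h2 := hsz.1
        change z * sinv (⟨z, hz⟩ : T) * z = z at h1
        grind [mul_assoc])

theorem wEquiv_symm_image :
    letI := (hT.isAdmissible hS).semigroup
    (hT.wEquiv hS).symm '' (T : Set S) = (hT.bandPair hS).W₀ := by
  let := (hT.isAdmissible hS).semigroup
  have key : ∀ x : T, hT.wEquiv hS ((hT.bandPair hS).ofBase x) = x := by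
    intro x
    change (x : S) * sinv x * x * (sinv x * x) = x
    rw [(coe_isInverse_sinv x).1, ← mul_assoc, (coe_isInverse_sinv x).1]
  ext s
  constructor
  · rintro ⟨x, hx, rfl⟩
    rw [show x = _ from (key ⟨x, hx⟩).symm, MulEquiv.symm_apply_apply]
    exact BandPair.ofBase_mem _
  · intro hs
    refine ⟨s.x, s.x.2, ?_⟩
    rw [MulEquiv.symm_apply_eq, BandPair.mem_W₀_iff.1 hs]
    exact (key s.x).symm

end IsInverseTransversal
end InvTransversal

theorem mainTheorem2 :
    (∀ (S₀ : Type u) (I : Type v) (Λ : Type w) [Semigroup S₀] [InvTransversal.IsInverseSemigroup S₀]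
      [Semigroup I] [Semigroup Λ] (B : InvTransversal.BandPair S₀ I Λ)
      (α : S₀ → S₀ → (Λ × I →. I)) (β : S₀ → S₀ → (Λ × I →. Λ)),
      B.IsAdmissible α β →
        ∃ _ : Semigroup B.W,
          InvTransversal.BandPair.IsProduct α β (fun s t : B.W => s * t) ∧
          InvTransversal.IsOrthodox B.W ∧
          ∃ T : Subsemigroup B.W,
            (T : Set B.W) = B.W₀ ∧
            InvTransversal.IsInverseTransversal T ∧
            Nonempty (T ≃* S₀) ∧
            (B.IsCompatible α β →
              (∃ J : Subsemigroup B.W,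
                (J : Set B.W) = InvTransversal.ISet T ∧ Nonempty (J ≃* I)) ∧
              (∃ M : Subsemigroup B.W,
                (M : Set B.W) = InvTransversal.LambdaSet T ∧ Nonempty (M ≃* Λ)))) ∧
    (∀ (S : Type u) [Semigroup S] (S₀ : Subsemigroup S),
      InvTransversal.IsOrthodox S → InvTransversal.IsInverseTransversal S₀ →
        ∃ (_ : InvTransversal.IsInverseSemigroup S₀) (I Λ : Subsemigroup S)
          (B : InvTransversal.BandPair S₀ I Λ)
          (α : S₀ → S₀ → (Λ × I →. I)) (β : S₀ → S₀ → (Λ × I →. Λ)),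
          (I : Set S) = InvTransversal.ISet S₀ ∧
          (Λ : Set S) = InvTransversal.LambdaSet S₀ ∧
          (∀ p, (B.inI p : S) = ((p : S₀) : S)) ∧
          (∀ p, (B.inΛ p : S) = ((p : S₀) : S)) ∧
          B.IsAdmissible α β ∧
          B.IsCompatible α β ∧
          ∃ _ : Semigroup B.W,
            InvTransversal.BandPair.IsProduct α β (fun s t : B.W => s * t) ∧
            ∃ φ : S ≃* B.W, φ '' (S₀ : Set S) = B.W₀) := by
  refine ⟨fun S₀ I Λ _ _ _ _ B α β h => ?_, fun S _ S₀ hS hT => ?_⟩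
  · let := h.semigroup
    exact ⟨h.semigroup, h.isProduct_mul, h.isOrthodox, h.base, rfl, h.isInverseTransversal_base,
      ⟨h.baseEquiv⟩, fun hc => ⟨⟨_, rfl, h.nonempty_ISubsemigroup_mulEquiv hc⟩,
        ⟨_, rfl, h.nonempty_LambdaSubsemigroup_mulEquiv hc⟩⟩⟩
  · have := hT.inverse
    let := (hT.isAdmissible hS).semigroup
    exact ⟨hT.inverse, hT.ISubsemigroup hS, hT.LambdaSubsemigroup hS, hT.bandPair hS,
      hT.α hS, hT.β hS, rfl, rfl, fun _ => rfl, fun _ => rfl, hT.isAdmissible hS,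
      hT.isCompatible hS, (hT.isAdmissible hS).semigroup, (hT.isAdmissible hS).isProduct_mul,
      (hT.wEquiv hS).symm, hT.wEquiv_symm_image hS⟩
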